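/- **Setting.** Let $\mathcal{D}\subseteq\mathbb{R}^N$ and let $\{f(\cdot;x)\}_{x\in\mathcal{D}}$ be probability densities on $\mathbb{R}^M$ with respect to a measure $\mu$. Let $x_0\in\mathcal{D}$ with $f(y;x_0)\neq 0$ for $\mu$-almost every $y$, write $\mathsf{E}_{x}$ for expectation under $f(\cdot;x)$, and put $\rho(y,x)=f(y;x)/f(y;x_0)$ and $R(x_1,x_2)=\mathsf{E}_{x_0}\{\rho(y,x_1)\rho(y,x_2)\}$, assumed finite for all $x_1,x_2\in\mathcal{D}$. Assume that the model is regular up to order 1 at $x_0$, i.e. there is an open ball $B\subseteq\mathcal{D}$ centred at $x_0$ such that, for all multi-indices $p,p_1,p_2\in\{0,1\}^N$: (i) the partial derivatives $\partial^p_x f(y;x)$ exist and $\mathsf{E}_{x_0}\{(f(y;x_0)^{-1}\partial_x^p f(y;x))^2\}<\infty$ for all $x\in B$; (ii) $\partial^p_x\int h(y)f(y;x)\,d\mu(y)$ exists and equals $\int h(y)\,\partial_x^p f(y;x)\,d\mu(y)$ on $B$ for every $h$ for which $\mathsf{E}_x\{h(y)\}$ exists for all $x\in\mathcal{D}$ and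 the right-hand side is finite on $B$; (iii) $\mathsf{E}_{x_0}\{f(y;x_0)^{-2}\,\partial^{p_1}f(y;x_1)\,\partial^{p_2}f(y;x_2)\}$ is continuous in $(x_1,x_2)\in B\times B$. Let $c:\mathbb{R}^N\to\mathbb{R}^Q$, $Q\le N$, be continuously differentiable, let the parameter set be $\mathcal{X}=\{x\in\mathcal{D}: c(x)=0\}$, and assume that $x_0\in\mathcal{X}$ and that the Jacobian of $c$ has rank $Q$ at every point of $\mathcal{X}$. Let $\mathcal{H}$ be the reproducing kernel Hilbert space of functions on $\mathcal{X}$ with kernel $R$ restricted to $\mathcal{X}\times\mathcal{X}$. Let $U\in\mathbb{R}^{N\times(N-Q)}$ be a matrix whose columns form an orthonormal basis of the null space of the Jacobian of $c$ at $x_0$. Let $r:\mathcal{O}\to\mathcal{X}$ be continuously differentiable on an open set $\mathcal{O}\subseteq\mathbb{R}^{N-Q}$, with $r(\theta_0)=x_0$ for some $\theta_0\in\mathcal{O}$ and with Jacobian of rank $N-Q$ at $\theta_0$. Let $J$, with $J_{k,l}=\mathsf{E}_{x_0}\{\partial_{x_k}\log f(y;x)\,\partial_{x_l}\log f(y;x)|_{x=x_0}\}$,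 be the Fisher information matrix at $x_0$. **Theorem 2 (constrained Cramér–Rao bound).** Let $\hat g:\mathbb{R}^M\to\mathbb{R}$ be a measurable estimator with finite variance $v(\hat g;x_0)$ at $x_0$, let $\gamma(x)=\mathsf{E}_x\{\hat g(y)\}$, and let $b=\partial\gamma/\partial x|_{x_0}$. Then $b$ and $J$ are well defined, $\gamma|_{\mathcal{X}}\in\mathcal{H}$, and the functions $$u_0=R(\cdot,x_0),\qquad u_l=\frac{\partial R(\cdot,r(\theta))}{\partial\theta_l}\Big|_{\theta=\theta_0},\quad l=1,\dots,N-Q,$$ exist and belong to $\mathcal{H}$. If $\gamma_{\mathcal{U}}$ denotes the orthogonal projection in $\mathcal{H}$ of $\gamma|_{\mathcal{X}}$ onto $\mathcal{U}=\mathrm{span}\{u_0,u_1,\dots,u_{N-Q}\}$, then $$v(\hat g;x_0)\;\ge\;\|\gamma_{\mathcal{U}}\|^2_{\mathcal{H}}-\gamma(x_0)^2\;=\;b^TU\,(U^TJU)^\dagger\,U^Tb,$$ where $^\dagger$ denotes the Moore–Penrose pseudoinverse. -/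

import Mathlib

open MeasureTheory
open scoped Matrix

/-! ## Moore-Penrose pseudoinverse of a real matrix -/

/-- The four Penrose conditions: `B` is a Moore-Penrose pseudoinverse of `A`. -/
structure IsMoorePenrose {m n : Type*} [Fintype m] [Fintype n]
    (A : Matrix m n ℝ) (B : Matrix n m ℝ) : Prop where
  mul_mul_left : A * B * A = A
  mul_mul_right : B * A * B = B
  symm_left : (A * B)ᵀ = A * B
  symm_right : (B * A)ᵀ = B * A

theorem IsMoorePenrose.unique {m n : Type*} [Fintype m] [Fintype n]
    {A : Matrix m n ℝ} {B C : Matrix n m ℝ}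
    (hB : IsMoorePenrose A B) (hC : IsMoorePenrose A C) : B = C := by
  have h1 : A * B = A * C := by
    calc A * B = (A * B)ᵀ := hB.symm_left.symm
      _ = ((A * C) * (A * B))ᵀ := by
          rw [← Matrix.mul_assoc (A * C), hC.mul_mul_left]
      _ = (A * B) * (A * C) := by
          rw [Matrix.transpose_mul, hB.symm_left, hC.symm_left]
      _ = A * C := by rw [← Matrix.mul_assoc (A * B), hB.mul_mul_left]
  have h2 : B * A = C * A := by
    calc B * A = (B * A)ᵀ := hB.symm_right.symm
      _ = ((B * A) * (C * A))ᵀ := by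
          rw [Matrix.mul_assoc B A, ← Matrix.mul_assoc A C A, hC.mul_mul_left]
      _ = (C * A) * (B * A) := by
          rw [Matrix.transpose_mul, hB.symm_right, hC.symm_right]
      _ = C * A := by
          rw [Matrix.mul_assoc C A, ← Matrix.mul_assoc A B A, hB.mul_mul_left]
  calc B = B * A * B := hB.mul_mul_right.symm
    _ = C * (A * C) := by rw [h2, Matrix.mul_assoc, h1]
    _ = C := by rw [← Matrix.mul_assoc, hC.mul_mul_right]

theorem exists_isMoorePenrose {m n : Type*} [Fintype m] [Fintype n]
    (A : Matrix m n ℝ) : ∃ B : Matrix n m ℝ, IsMoorePenrose A B := by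
  classical
  have hS : (Aᵀ * A).IsHermitian := by
    simp [Matrix.IsHermitian, Matrix.conjTranspose_eq_transpose_of_trivial, Matrix.transpose_mul]
  obtain ⟨V, d, hV, hSd⟩ : ∃ (V : Matrix n n ℝ) (d : n → ℝ), Vᵀ * V = 1 ∧
      Aᵀ * A = V * Matrix.diagonal d * Vᵀ := by
    refine ⟨(hS.eigenvectorUnitary : Matrix n n ℝ), hS.eigenvalues, ?_, ?_⟩
    · have := (Matrix.mem_unitaryGroup_iff').1 hS.eigenvectorUnitary.2
      simpa [Matrix.star_eq_conjTranspose, Matrix.conjTranspose_eq_transpose_of_trivial] using this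
    · have := hS.spectral_theorem
      simpa [Unitary.conjStarAlgAut_apply, Matrix.star_eq_conjTranspose,
        Matrix.conjTranspose_eq_transpose_of_trivial, Function.comp_def] using this
  set T : Matrix n n ℝ := V * Matrix.diagonal (fun i => (d i)⁻¹) * Vᵀ with hT
  have key : ∀ a b : n → ℝ, (V * Matrix.diagonal a * Vᵀ) * (V * Matrix.diagonal b * Vᵀ)
      = V * Matrix.diagonal (fun i => a i * b i) * Vᵀ := by
    intro a b
    calc _ = V * Matrix.diagonal a * (Vᵀ * V) * Matrix.diagonal b * Vᵀ := by
          simp only [Matrix.mul_assoc]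
      _ = _ := by rw [hV, Matrix.mul_one, Matrix.mul_assoc V, Matrix.diagonal_mul_diagonal]
  have sym : ∀ a : n → ℝ, (V * Matrix.diagonal a * Vᵀ)ᵀ = V * Matrix.diagonal a * Vᵀ := by
    intro a
    simp [Matrix.transpose_mul, Matrix.mul_assoc]
  have hTS : T * (Aᵀ * A) = V * Matrix.diagonal (fun i => (d i)⁻¹ * d i) * Vᵀ := by
    rw [hSd, hT, key]
  have hTSsym : (T * (Aᵀ * A))ᵀ = T * (Aᵀ * A) := by rw [hTS, sym]
  have hSTS : (Aᵀ * A) * (T * (Aᵀ * A)) = Aᵀ * A := by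
    rw [hTS, hSd, key]
    congr 3
    funext i
    by_cases h : d i = 0 <;> simp [h]
  have hTST : (T * (Aᵀ * A)) * T = T := by
    rw [hTS, hT, key]
    congr 3
    funext i
    by_cases h : d i = 0 <;> simp [h]
  have hATS : A * (T * (Aᵀ * A)) = A := by
    have h0 : (A * (T * (Aᵀ * A)) - A)ᵀ * (A * (T * (Aᵀ * A)) - A) = 0 := by
      rw [Matrix.transpose_sub, Matrix.transpose_mul, hTSsym, Matrix.sub_mul, Matrix.mul_sub,
        Matrix.mul_sub]
      have e1 : Aᵀ * (A * (T * (Aᵀ * A))) = Aᵀ * A := by rw [← Matrix.mul_assoc, hSTS]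
      rw [Matrix.mul_assoc _ Aᵀ (A * _), e1, Matrix.mul_assoc _ Aᵀ A]
      simp
    have := (Matrix.conjTranspose_mul_self_eq_zero
      (A := A * (T * (Aᵀ * A)) - A)).1
      (by rw [Matrix.conjTranspose_eq_transpose_of_trivial]; exact h0)
    exact sub_eq_zero.1 this
  refine ⟨T * Aᵀ, ⟨?_, ?_, ?_, ?_⟩⟩
  · simpa only [Matrix.mul_assoc] using hATS
  · have : T * Aᵀ * A * (T * Aᵀ) = (T * (Aᵀ * A)) * T * Aᵀ := by simp only [Matrix.mul_assoc]
    rw [this, hTST]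
  · rw [Matrix.transpose_mul, Matrix.transpose_mul, Matrix.transpose_transpose, hT, sym,
      Matrix.mul_assoc]
  · simpa only [Matrix.mul_assoc] using hTSsym

/-- The Moore-Penrose pseudoinverse `A†`. -/
noncomputable def pinv {m n : Type*} [Fintype m] [Fintype n]
    (A : Matrix m n ℝ) : Matrix n m ℝ :=
  (exists_isMoorePenrose A).choose

theorem pinv_spec {m n : Type*} [Fintype m] [Fintype n]
    (A : Matrix m n ℝ) : IsMoorePenrose A (pinv A) :=
  (exists_isMoorePenrose A).choose_spec

/-! ## Partial derivatives -/

/-- The partial derivative `∂F/∂x_k`. -/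
noncomputable def partialDeriv {N : ℕ} (k : Fin N) (F : EuclideanSpace ℝ (Fin N) → ℝ) :
    EuclideanSpace ℝ (Fin N) → ℝ :=
  fun x => lineDeriv ℝ F x (EuclideanSpace.single k 1)

/-- The partial derivative `∂^p F / ∂x^p = ∂_1^{p_1} ⋯ ∂_N^{p_N} F` for a multi-index `p`. -/
noncomputable def multiPartial {N : ℕ} (p : Fin N → ℕ) (F : EuclideanSpace ℝ (Fin N) → ℝ) :
    EuclideanSpace ℝ (Fin N) → ℝ :=
  (List.finRange N).foldr (fun k G => (partialDeriv k)^[p k] G) F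

/-- `∂^p F` exists on `S`: every single differentiation performed in building
`∂_1^{p_1} ⋯ ∂_N^{p_N} F` (starting with the last coordinate) is legitimate at every point
of `S`. -/
def HasMultiPartialOn {N : ℕ} (p : Fin N → ℕ) (F : EuclideanSpace ℝ (Fin N) → ℝ)
    (S : Set (EuclideanSpace ℝ (Fin N))) : Prop :=
  ∀ k : Fin N, ∀ j < p k, ∀ x ∈ S,
    LineDifferentiableAt ℝ
      (multiPartial (fun i => if i < k then 0 else if i = k then j else p i) F) x
      (EuclideanSpace.single k 1)

/-- The Jacobian matrix of a vector-valued function. -/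
noncomputable def jacobian {N Q : ℕ} (c : EuclideanSpace ℝ (Fin N) → EuclideanSpace ℝ (Fin Q))
    (x : EuclideanSpace ℝ (Fin N)) : Matrix (Fin Q) (Fin N) ℝ :=
  Matrix.of fun i k => (fderiv ℝ c x (EuclideanSpace.single k 1)) i

/-! ## Estimation problems -/

/-- An estimation problem `(X, f(y;x), g)`: a parameter set `X ⊆ ℝ^N`, a family of probability
densities `f(·;x)`, `x ∈ X`, on `ℝ^M` with respect to a dominating measure, and a real-valued
parameter function `g`. Values of `pdf x` and `g x` for `x ∉ X` are irrelevant. -/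
structure EstimationProblem (N M : ℕ) where
  paramSet : Set (EuclideanSpace ℝ (Fin N))
  base : Measure (EuclideanSpace ℝ (Fin M))
  pdf : EuclideanSpace ℝ (Fin N) → EuclideanSpace ℝ (Fin M) → ℝ
  g : EuclideanSpace ℝ (Fin N) → ℝ
  measurable_pdf : ∀ x ∈ paramSet, Measurable (pdf x)
  pdf_nonneg : ∀ x ∈ paramSet, ∀ y, 0 ≤ pdf x y
  lintegral_pdf : ∀ x ∈ paramSet, ∫⁻ y, ENNReal.ofReal (pdf x y) ∂base = 1

namespace EstimationProblem

variable {N M : ℕ} (P : EstimationProblem N M)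

/-- The probability measure with density `f(·;x)`. -/
noncomputable def law (x : EuclideanSpace ℝ (Fin N)) : Measure (EuclideanSpace ℝ (Fin M)) :=
  P.base.withDensity fun y => ENNReal.ofReal (P.pdf x y)

/-- The mean function `γ(x) = E_x{h(y)} = ∫ h(y) f(y;x) dy`. -/
noncomputable def mean (h : EuclideanSpace ℝ (Fin M) → ℝ) (x : EuclideanSpace ℝ (Fin N)) : ℝ :=
  ∫ y, h y * P.pdf x y ∂P.base

/-- The likelihood ratio `f(y;x) / f(y;x₀)` (zero where `f(y;x₀) = 0`). -/
noncomputable def likelihoodRatio (x₀ x : EuclideanSpace ℝ (Fin N))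
    (y : EuclideanSpace ℝ (Fin M)) : ℝ :=
  P.pdf x y / P.pdf x₀ y

/-- The kernel `R(x₁, x₂) = E_{x₀}{ρ(y, x₁) ρ(y, x₂)}`, `ρ` being the likelihood ratio. -/
noncomputable def kernel (x₀ x₁ x₂ : EuclideanSpace ℝ (Fin N)) : ℝ :=
  ∫ y, P.likelihoodRatio x₀ x₁ y * P.likelihoodRatio x₀ x₂ y ∂P.law x₀

/-- The Fisher information matrix at `x₀`. -/
noncomputable def fisher (x₀ : EuclideanSpace ℝ (Fin N)) : Matrix (Fin N) (Fin N) ℝ :=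
  Matrix.of fun k l => ∫ y, partialDeriv k (fun x => Real.log (P.pdf x y)) x₀ *
    partialDeriv l (fun x => Real.log (P.pdf x y)) x₀ ∂P.law x₀

end EstimationProblem

/-- An estimation problem with a reference parameter vector `x₀` such that `f(y;x₀) ≠ 0` for
almost all `y` and all the expectations `E_{x₀}{ρ(y, x₁) ρ(y, x₂)}`, `x₁, x₂ ∈ X`, are finite. -/
structure ReferencedProblem (N M : ℕ) extends EstimationProblem N M where
  x₀ : EuclideanSpace ℝ (Fin N)
  x₀_mem : x₀ ∈ paramSet
  pdf_ne_zero : ∀ᵐ y ∂base, pdf x₀ y ≠ 0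
  integrable_ratio : ∀ x₁ ∈ paramSet, ∀ x₂ ∈ paramSet, Integrable
    (fun y => toEstimationProblem.likelihoodRatio x₀ x₁ y *
      toEstimationProblem.likelihoodRatio x₀ x₂ y) (toEstimationProblem.law x₀)

namespace ReferencedProblem

variable {N M : ℕ}

/-- The problem with the same statistical model, parameter function and reference vector, but
with the smaller parameter set `X ∩ S`. -/
def restrict (P : ReferencedProblem N M) (S : Set (EuclideanSpace ℝ (Fin N)))
    (hS : P.x₀ ∈ S) : ReferencedProblem N M where
  paramSet := P.paramSet ∩ S
  base := P.base
  pdf := P.pdf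
  g := P.g
  measurable_pdf x hx := P.measurable_pdf x hx.1
  pdf_nonneg x hx := P.pdf_nonneg x hx.1
  lintegral_pdf x hx := P.lintegral_pdf x hx.1
  x₀ := P.x₀
  x₀_mem := ⟨P.x₀_mem, hS⟩
  pdf_ne_zero := P.pdf_ne_zero
  integrable_ratio x₁ h₁ x₂ h₂ := P.integrable_ratio x₁ h₁.1 x₂ h₂.1

/-- The kernel on `X × X` in the operator-valued form used by Mathlib: the number `R(x₁, x₂)` is
identified with multiplication by it. -/
noncomputable def kernelMatrix (P : ReferencedProblem N M) :
    Matrix P.paramSet P.paramSet (ℝ →L[ℝ] ℝ) :=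
  Matrix.of fun x₁ x₂ => P.kernel P.x₀ x₁ x₂ • (1 : ℝ →L[ℝ] ℝ)

theorem posSemidef_kernelMatrix (P : ReferencedProblem N M) : P.kernelMatrix.PosSemidef := by
  have htfae := RKHS.posSemidef_tfae (K := P.kernelMatrix)
  refine (htfae.out 0 2).2 (And.intro ?_ fun v => ?_)
  · ext x₁ x₂
    simp [kernelMatrix, EstimationProblem.kernel, mul_comm]
  · have hsum : (v.sum fun x w => v.sum fun x' w' => inner ℝ (P.kernelMatrix x' x w) w')
        = ∫ y, (∑ x ∈ v.support, v x * P.likelihoodRatio P.x₀ x y) ^ 2 ∂P.law P.x₀ := by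
      simp_rw [sq, Finset.sum_mul_sum, Finsupp.sum]
      rw [integral_finsetSum]
      · refine Finset.sum_congr rfl fun x _ => ?_
        rw [integral_finsetSum]
        · refine Finset.sum_congr rfl fun x' _ => ?_
          simp only [kernelMatrix, EstimationProblem.kernel, Matrix.of_apply]
          have : ∀ y, v x * P.likelihoodRatio P.x₀ x y * (v x' * P.likelihoodRatio P.x₀ x' y)
              = (v x * v x') * (P.likelihoodRatio P.x₀ x' y * P.likelihoodRatio P.x₀ x y) :=
            fun y => by ring
          simp_rw [this]
          rw [integral_const_mul]
          simp
          ring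
        · intro x' _
          have := (P.integrable_ratio x x.2 x' x'.2).const_mul (v x * v x')
          refine this.congr (Filter.Eventually.of_forall fun y => ?_)
          simp only
          ring
      · intro x _
        refine integrable_finsetSum _ fun x' _ => ?_
        have := (P.integrable_ratio x x.2 x' x'.2).const_mul (v x * v x')
        refine this.congr (Filter.Eventually.of_forall fun y => ?_)
        simp only
        ring
    rw [hsum]
    exact integral_nonneg fun y => sq_nonneg _

instance (P : ReferencedProblem N M) : Fact P.kernelMatrix.PosSemidef :=
  ⟨P.posSemidef_kernelMatrix⟩

/-- The reproducing kernel Hilbert space, a Hilbert space of functions `X → ℝ`, with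
kernel `R`. -/
abbrev Space (P : ReferencedProblem N M) : Type := RKHS.OfKernel P.kernelMatrix

/-- The problem is regular up to order `m` at its reference vector `x₀`, which is an interior
point of the parameter set. -/
def IsRegular (P : ReferencedProblem N M) (m : ℕ) : Prop :=
  ∃ r > 0, Metric.ball P.x₀ r ⊆ P.paramSet ∧
    -- the partial derivatives of the density exist and are square integrable
    (∀ p : Fin N → ℕ, (∀ k, p k ≤ m) →
      (∀ᵐ y ∂P.base, HasMultiPartialOn p (fun x => P.pdf x y) (Metric.ball P.x₀ r)) ∧
      ∀ x ∈ Metric.ball P.x₀ r, Integrable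
        (fun y => (1 / P.pdf P.x₀ y * multiPartial p (fun x => P.pdf x y) x) ^ 2)
        (P.law P.x₀)) ∧
    -- expectation and partial differentiation commute
    (∀ h : EuclideanSpace ℝ (Fin M) → ℝ,
      (∀ x ∈ P.paramSet, Integrable (fun y => h y * P.pdf x y) P.base) →
      ∀ p : Fin N → ℕ, (∀ k, p k ≤ m) →
      (∀ x ∈ Metric.ball P.x₀ r, Integrable
        (fun y => h y * multiPartial p (fun x => P.pdf x y) x) P.base) →
      HasMultiPartialOn p (P.mean h) (Metric.ball P.x₀ r) ∧
      ∀ x ∈ Metric.ball P.x₀ r, multiPartial p (P.mean h) x =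
        ∫ y, h y * multiPartial p (fun x => P.pdf x y) x ∂P.base) ∧
    -- the correlations of the partial derivatives are continuous
    (∀ p₁ p₂ : Fin N → ℕ, (∀ k, p₁ k ≤ m) → (∀ k, p₂ k ≤ m) →
      ContinuousOn (fun z : EuclideanSpace ℝ (Fin N) × EuclideanSpace ℝ (Fin N) =>
        ∫ y, 1 / P.pdf P.x₀ y ^ 2 * multiPartial p₁ (fun x => P.pdf x y) z.1 *
          multiPartial p₂ (fun x => P.pdf x y) z.2 ∂P.law P.x₀)
        (Metric.ball P.x₀ r ×ˢ Metric.ball P.x₀ r))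

end ReferencedProblem

/-- The linear span of `u₀` and `u_1, …, u_L`. -/
def spanWith {H : Type*} [AddCommGroup H] [Module ℝ H] {L : ℕ} (u₀ : H) (u : Fin L → H) :
    Submodule ℝ H :=
  Submodule.span ℝ (insert u₀ (Set.range u))

instance {H : Type*} [AddCommGroup H] [Module ℝ H] {L : ℕ} (u₀ : H) (u : Fin L → H) :
    FiniteDimensional ℝ (spanWith u₀ u) :=
  FiniteDimensional.span_of_finite ℝ ((Set.finite_range u).insert u₀)

/-! All statistics are viewed in the single Hilbert space L² of the law at `x₀`. The mean of `h` at
`x` is the inner product of `h` with the likelihood ratio at `x`, and inner products of ratios are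
the kernel values. Sending kernel functions to ratios therefore gives an isometry `Φ` of the RKHS
into L² (`exists_linearIsometry`), and its adjoint sends a statistic to its mean function. So γ is
the adjoint image of `ghat`, and u₀ corresponds to the constant 1.

Regularity supplies partial derivatives of mean functions, as inner products with the scores.
Continuity of the score correlations makes the scores norm continuous at `x₀`, so these partial
derivatives are continuous there and mean functions are Fréchet differentiable
(`IsRegular.hasFDerivAt_mean`). The chain rule along `r` then shows that u_l corresponds to w_l = ∑ₖ
A k l • sₖ, with sₖ the scores at `x₀` and A the Jacobian of `r`.

Scores have mean zero, so the u_l are orthogonal to u₀. Their Gram matrix is AᵀJA and their inner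
products with γ form Aᵀb. Since c ∘ r = 0 near θ₀, A = UB with B = UᵀA invertible. The normal
equations become UᵀJU(Bz) = Uᵀb, so Uᵀb lies in the range of UᵀJU, and the pseudoinverse form equals
the squared norm of the projection minus γ(x₀)². The variance bound holds because neither the
projection nor the adjoint of an isometry increases norms. -/

/-! ### Differentiability from continuous partial derivatives. -/

/-- A function with partial derivatives near `x`, all continuous at `x`, is Fréchet
differentiable at `x`. -/
theorem hasFDerivAt_of_hasLineDerivAt_single {N : ℕ} {F : EuclideanSpace ℝ (Fin N) → ℝ}
    {D : Fin N → EuclideanSpace ℝ (Fin N) → ℝ} {x : EuclideanSpace ℝ (Fin N)} {r : ℝ} (hr : 0 < r)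
    (hF : ∀ k, ∀ z ∈ Metric.ball x r, HasLineDerivAt ℝ F (D k z) z (EuclideanSpace.single k 1))
    (hD : ∀ k, ContinuousAt (D k) x) :
    HasFDerivAt F (∑ k, D k x • (EuclideanSpace.proj k : EuclideanSpace ℝ (Fin N) →L[ℝ] ℝ)) x := by
  rw [hasFDerivAt_iff_isLittleO_nhds_zero, Asymptotics.isLittleO_iff]
  intro C hC
  -- Each of the N coordinate moves costs at most ε‖v‖; the `+ 1` keeps the denominator positive
  -- when N = 0.
  set ε := C / (N + 1) with hε
  have hεpos : 0 < ε := by positivity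
  obtain ⟨δ, hδ, hδr, hclose⟩ : ∃ δ > 0, δ ≤ r ∧ ∀ z ∈ Metric.ball x δ, ∀ k,
      |D k z - D k x| ≤ ε := by
    have : ∀ᶠ z in nhds x, ∀ k, |D k z - D k x| ≤ ε := by
      rw [Filter.eventually_all]
      intro k
      filter_upwards [Metric.continuousAt_iff'.1 (hD k) ε hεpos] with z hz
      exact le_of_lt (by simpa [Real.dist_eq] using hz)
    obtain ⟨δ, hδ, h⟩ := Metric.eventually_nhds_iff_ball.1 this
    exact ⟨min δ r, lt_min hδ hr, min_le_right _ _, fun z hz =>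
      h z (Metric.ball_subset_ball (min_le_left _ _) hz)⟩
  filter_upwards [Metric.ball_mem_nhds (0 : EuclideanSpace ℝ (Fin N)) hδ] with v hv
  rw [mem_ball_zero_iff] at hv
  -- Corners of a path from x to x + v that switches on one coordinate of v at a time; the path
  -- stays in the ball because truncation does not increase the norm.
  let w : Finset (Fin N) → EuclideanSpace ℝ (Fin N) := fun S =>
    WithLp.toLp 2 fun i => if i ∈ S then v i else 0
  have hnorm : ∀ (u : EuclideanSpace ℝ (Fin N)), (∀ i, |u i| ≤ |v i|) → ‖u‖ ≤ ‖v‖ := by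
    intro u hu
    rw [EuclideanSpace.norm_eq, EuclideanSpace.norm_eq]
    exact Real.sqrt_le_sqrt (Finset.sum_le_sum fun i _ => pow_le_pow_left₀ (norm_nonneg _)
      (by simpa using hu i) 2)
  have key : ∀ S : Finset (Fin N),
      |F (x + w S) - F x - ∑ k ∈ S, D k x * v k| ≤ S.card * (ε * ‖v‖) := by
    intro S
    induction S using Finset.induction_on with
    | empty =>
      have : w ∅ = 0 := by ext i; simp [w]
      simp [this]
    | insert k S hk ih =>
      have hstep : |F (x + w (insert k S)) - F (x + w S) - D k x * v k| ≤ ε * ‖v‖ := by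
        have hmem : ∀ t ∈ Set.Icc (0 : ℝ) 1,
            x + w S + (t * v k) • EuclideanSpace.single k 1 ∈ Metric.ball x δ := by
          intro t ht
          rw [add_assoc, Metric.mem_ball, dist_self_add_left]
          refine lt_of_le_of_lt (hnorm _ fun i => ?_) hv
          by_cases hi : i = k
          · subst hi
            simp only [w, PiLp.add_apply, if_neg hk, PiLp.smul_apply, PiLp.single_apply, if_true,
              zero_add, smul_eq_mul, mul_one, abs_mul, abs_of_nonneg ht.1]
            exact mul_le_of_le_one_left (abs_nonneg _) ht.2
          · by_cases hiS : i ∈ S <;> simp [w, hiS, hi]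
        -- With the linear part subtracted, the derivative along the segment is at most ε‖v‖ in
        -- size, so the mean value inequality bounds the step.
        have hder : ∀ t ∈ Set.Icc (0 : ℝ) 1, HasDerivWithinAt
            (fun t => F (x + w S + (t * v k) • EuclideanSpace.single k 1) - t * (D k x * v k))
            ((D k (x + w S + (t * v k) • EuclideanSpace.single k 1) - D k x) * v k)
            (Set.Icc 0 1) t := by
          intro t ht
          have h1 := hF k _ (Metric.ball_subset_ball hδr (hmem t ht))
          rw [HasLineDerivAt] at h1
          have h2 : HasDerivAt (fun s : ℝ => (s - t) * v k) (v k) t := by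
            simpa using ((hasDerivAt_id t).sub_const t).mul_const (v k)
          have h3 := HasDerivAt.comp_of_eq t h1 h2 (by simp)
          have h4 := h3.sub ((hasDerivAt_id t).mul_const (D k x * v k))
          refine (h4.congr_deriv (by ring)).hasDerivWithinAt.congr_of_eventuallyEq
            (Filter.Eventually.of_forall fun s => ?_) ?_
          · simp only [Function.comp_apply, Pi.sub_apply, id]
            congr 2
            rw [add_assoc (x + w S), ← add_smul]
            congr 2
            ring
          · simp only [Function.comp_apply, Pi.sub_apply, id]
            simp
        have := norm_image_sub_le_of_norm_deriv_le_segment_01' hder (C := ε * ‖v‖) fun t ht => by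
          rw [norm_mul]
          have hvk : ‖v k‖ ≤ ‖v‖ := PiLp.norm_apply_le v k
          exact mul_le_mul (by simpa using hclose _ (hmem t ⟨ht.1, ht.2.le⟩) k) hvk
            (norm_nonneg _) hεpos.le
        have hw : x + w S + v k • EuclideanSpace.single k 1 = x + w (insert k S) := by
          rw [add_assoc]
          congr 1
          ext i
          by_cases hi : i = k
          · subst hi; simp [w, hk]
          · simp [w, hi]
        rw [one_mul, hw] at this
        simpa [sub_right_comm] using this
      rw [Finset.sum_insert hk, Finset.card_insert_of_notMem hk]
      push_cast
      calc _ = |(F (x + w (insert k S)) - F (x + w S) - D k x * v k)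
            + (F (x + w S) - F x - ∑ k ∈ S, D k x * v k)| := by congr 1; ring
        _ ≤ _ := abs_add_le _ _
        _ ≤ ε * ‖v‖ + S.card * (ε * ‖v‖) := add_le_add hstep ih
        _ = _ := by ring
  have h := key Finset.univ
  have hw : w Finset.univ = v := by ext i; simp [w]
  rw [hw, Finset.card_univ, Fintype.card_fin] at h
  have hsum : (∑ k, D k x • (EuclideanSpace.proj k : EuclideanSpace ℝ (Fin N) →L[ℝ] ℝ)) v
      = ∑ k, D k x * v k := by
    simp
  rw [hsum, Real.norm_eq_abs]
  refine h.trans ?_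
  rw [← mul_assoc]
  refine mul_le_mul_of_nonneg_right ?_ (norm_nonneg _)
  rw [hε, ← mul_div_assoc, div_le_iff₀ (by positivity)]
  nlinarith

/-! ### Hilbert space and matrix algebra. -/

/-- A bounded linear isometry with prescribed values on a family of dense span. -/
theorem exists_linearIsometry_of_inner_eq {ι H L : Type*} [NormedAddCommGroup H]
    [InnerProductSpace ℝ H] [NormedAddCommGroup L] [InnerProductSpace ℝ L] [CompleteSpace L]
    (κ : ι → H) (ρ : ι → L) (hκ : (Submodule.span ℝ (Set.range κ)).topologicalClosure = ⊤)
    (h : ∀ i j, inner ℝ (κ i) (κ j) = inner ℝ (ρ i) (ρ j)) :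
    ∃ Φ : H →ₗᵢ[ℝ] L, ∀ i, Φ (κ i) = ρ i := by
  set e := Finsupp.linearCombination ℝ κ
  set f := Finsupp.linearCombination ℝ ρ
  -- Equal Gram matrices give equal norms of formal combinations, so e a ↦ f a is well defined and
  -- isometric on a dense subspace.
  have hef : ∀ a, ‖f a‖ = ‖e a‖ := by
    intro a
    have : inner ℝ (f a) (f a) = inner ℝ (e a) (e a) := by
      simp only [f, e, Finsupp.linearCombination_apply, Finsupp.sum, sum_inner, inner_sum,
        inner_smul_left, inner_smul_right, h]
    rw [real_inner_self_eq_norm_sq, real_inner_self_eq_norm_sq] at this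
    exact (sq_eq_sq₀ (norm_nonneg _) (norm_nonneg _)).1 this
  have hdense : DenseRange e := by
    have h1 := Submodule.dense_iff_topologicalClosure_eq_top.2 hκ
    rw [← Finsupp.range_linearCombination] at h1
    rwa [LinearMap.coe_range] at h1
  have hext : ∀ a, f.extendOfNorm e (e a) = f a :=
    LinearMap.extendOfNorm_eq hdense ⟨1, fun a => by rw [hef, one_mul]⟩
  refine ⟨⟨(f.extendOfNorm e).toLinearMap, fun z => ?_⟩, fun i => ?_⟩
  · change ‖f.extendOfNorm e z‖ = ‖z‖
    refine hdense.induction_on (p := fun z => ‖f.extendOfNorm e z‖ = ‖z‖) z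
      (isClosed_eq (by fun_prop) (by fun_prop)) fun a => ?_
    rw [hext, hef]
  · have := hext (Finsupp.single i 1)
    simpa [e, f] using this

/-- The value of `vᵀ A† v` at a vector `v = A w` in the range of a symmetric matrix. -/
theorem dotProduct_pinv_mulVec_mulVec {n : Type*} [Fintype n] {A : Matrix n n ℝ} (hA : Aᵀ = A)
    (w : n → ℝ) : (A *ᵥ w) ⬝ᵥ (pinv A *ᵥ (A *ᵥ w)) = w ⬝ᵥ (A *ᵥ w) := by
  have h := (pinv_spec A).mul_mul_left
  calc _ = w ⬝ᵥ (Aᵀ *ᵥ (pinv A *ᵥ (A *ᵥ w))) := by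
        rw [Matrix.dotProduct_mulVec w, Matrix.vecMul_transpose]
    _ = _ := by rw [hA, Matrix.mulVec_mulVec, Matrix.mulVec_mulVec, h]

theorem Matrix.isUnit_of_rank_eq {n : ℕ} {A : Matrix (Fin n) (Fin n) ℝ} (h : A.rank = n) :
    IsUnit A := by
  rw [← Matrix.mulVec_surjective_iff_isUnit]
  have : LinearMap.range A.mulVecLin = ⊤ := by
    apply Submodule.eq_top_of_finrank_eq
    rw [Module.finrank_fin_fun]
    exact h
  exact LinearMap.range_eq_top.1 this

/-- If the columns of `U` are an orthonormal basis of the null space of `C`, every matrix whose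
columns lie in that null space factors through `U`. -/
theorem mul_transpose_mul_of_mul_eq_zero {N Q L : ℕ} {C : Matrix (Fin Q) (Fin N) ℝ}
    (hC : C.rank = Q) {U : Matrix (Fin N) (Fin (N - Q)) ℝ} (hU : C * U = 0) (hUU : Uᵀ * U = 1)
    {A : Matrix (Fin N) (Fin L) ℝ} (hA : C * A = 0) : U * (Uᵀ * A) = A := by
  have hle : LinearMap.range U.mulVecLin ≤ LinearMap.ker C.mulVecLin := by
    rintro _ ⟨z, rfl⟩
    simp [LinearMap.mem_ker, Matrix.mulVec_mulVec, hU]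
  have hinj : Function.Injective U.mulVecLin := by
    intro a b hab
    have := congrArg (fun z => Uᵀ *ᵥ z) hab
    simpa [Matrix.mulVec_mulVec, hUU] using this
  have hker : Module.finrank ℝ (LinearMap.ker C.mulVecLin) = N - Q := by
    have := LinearMap.finrank_range_add_finrank_ker C.mulVecLin
    rw [Module.finrank_fin_fun] at this
    have h2 : Module.finrank ℝ (LinearMap.range C.mulVecLin) = Q := hC
    omega
  -- Both spaces have dimension N - Q: U is injective by `hUU`, and rank-nullity applies to C.
  have heq : LinearMap.range U.mulVecLin = LinearMap.ker C.mulVecLin := by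
    apply Submodule.eq_of_le_of_finrank_eq hle
    rw [LinearMap.finrank_range_of_inj hinj, Module.finrank_fin_fun, hker]
  ext i l
  have hcol : A.col l ∈ LinearMap.range U.mulVecLin := by
    rw [heq, LinearMap.mem_ker]
    ext q
    exact congrFun (congrFun hA q) l
  obtain ⟨z, hz⟩ := hcol
  have hz' : U *ᵥ z = A.col l := hz
  have h1 : (U * (Uᵀ * A)).col l = U *ᵥ (Uᵀ *ᵥ A.col l) := by
    ext i
    simp [Matrix.mul_apply, Matrix.mulVec, dotProduct]
  have : (U * (Uᵀ * A)).col l = A.col l := by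
    rw [h1, ← hz', Matrix.mulVec_mulVec _ Uᵀ, hUU, Matrix.one_mulVec]
  exact congrFun this i

/-- Orthogonal projection onto the span of a unit vector and of vectors orthogonal to it, through
the normal equations. -/
theorem exists_norm_sq_starProjection_spanWith {H : Type*} [NormedAddCommGroup H]
    [InnerProductSpace ℝ H] {L : ℕ} {u₀ : H} {u : Fin L → H} (γ : H) (hu₀ : inner ℝ u₀ u₀ = (1 : ℝ))
    (hu : ∀ l, inner ℝ u₀ (u l) = (0 : ℝ)) :
    ∃ z : Fin L → ℝ, Matrix.of (fun l m => inner ℝ (u l) (u m)) *ᵥ z = (fun l => inner ℝ (u l) γ) ∧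
      ‖(spanWith u₀ u).starProjection γ‖ ^ 2 - (inner ℝ u₀ γ) ^ 2
        = z ⬝ᵥ (Matrix.of (fun l m => inner ℝ (u l) (u m)) *ᵥ z) := by
  set p := (spanWith u₀ u).starProjection γ with hp
  have hpmem : p ∈ spanWith u₀ u := Submodule.starProjection_apply_mem _ _
  obtain ⟨α, q, hq, hpq⟩ := Submodule.mem_span_insert.1 hpmem
  obtain ⟨z, rfl⟩ := (Submodule.mem_span_range_iff_exists_fun ℝ).1 hq
  have horth : ∀ v ∈ spanWith u₀ u, inner ℝ v p = inner ℝ v γ := by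
    intro v hv
    have := Submodule.starProjection_inner_eq_zero (K := spanWith u₀ u) γ v hv
    rw [inner_sub_left, sub_eq_zero] at this
    rw [real_inner_comm, ← this, real_inner_comm]
  have hu' : ∀ l, inner ℝ (u l) u₀ = (0 : ℝ) := fun l => by rw [real_inner_comm, hu]
  have h0 : α = inner ℝ u₀ γ := by
    rw [← horth u₀ (Submodule.subset_span (Set.mem_insert _ _)), hpq]
    simp [inner_add_right, inner_sum, inner_smul_right, hu, hu₀, -inner_self_eq_norm_sq_to_K]
  have hl : Matrix.of (fun l m => inner ℝ (u l) (u m)) *ᵥ z = (fun l => inner ℝ (u l) γ) := by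
    funext l
    rw [← horth (u l) (Submodule.subset_span (Set.mem_insert_of_mem _ ⟨l, rfl⟩)), hpq]
    simp [inner_add_right, inner_sum, inner_smul_right, hu', Matrix.mulVec, dotProduct, mul_comm]
  refine ⟨z, hl, ?_⟩
  -- ‖p‖² = ⟨p, γ⟩; expanding only p on the left leaves α² plus the pairing of z with the right-hand
  -- side of the normal equations.
  rw [← real_inner_self_eq_norm_sq, horth p hpmem, hl]
  nth_rewrite 1 [hpq]
  simp only [inner_add_left, sum_inner, inner_smul_left, dotProduct, ← h0]
  simp
  ring

theorem inner_toLp_toLp {α : Type*} [MeasurableSpace α] {μ : Measure α} {f g : α → ℝ}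
    (hf : MemLp f 2 μ) (hg : MemLp g 2 μ) :
    inner ℝ (hf.toLp f) (hg.toLp g) = ∫ y, f y * g y ∂μ := by
  rw [L2.inner_def]
  refine integral_congr_ae ?_
  filter_upwards [hf.coeFn_toLp, hg.coeFn_toLp] with y h1 h2
  simp [h1, h2, mul_comm]

/-! ### Multi-indices of order at most one. -/

theorem multiPartial_zero {N : ℕ} (F : EuclideanSpace ℝ (Fin N) → ℝ) :
    multiPartial (fun _ => 0) F = F := by
  unfold multiPartial
  induction List.finRange N with
  | nil => rfl
  | cons a l ih => exact ih

theorem multiPartial_single {N : ℕ} (k : Fin N) (F : EuclideanSpace ℝ (Fin N) → ℝ) :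
    multiPartial (Pi.single k 1) F = partialDeriv k F := by
  have key : ∀ l : List (Fin N), l.Nodup →
      l.foldr (fun i G => (partialDeriv i)^[(Pi.single k 1 : Fin N → ℕ) i] G) F
        = if k ∈ l then partialDeriv k F else F := by
    intro l
    induction l with
    | nil => simp
    | cons a l ih =>
      intro hl
      rw [List.nodup_cons] at hl
      rw [List.foldr_cons, ih hl.2]
      by_cases ha : a = k
      · subst ha
        simp [hl.1]
      · simp [ha, Ne.symm ha]
  rw [multiPartial, key _ (List.nodup_finRange N), if_pos (List.mem_finRange k)]

theorem HasMultiPartialOn.lineDifferentiableAt {N : ℕ} {k : Fin N}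
    {F : EuclideanSpace ℝ (Fin N) → ℝ} {S : Set (EuclideanSpace ℝ (Fin N))}
    (h : HasMultiPartialOn (Pi.single k 1) F S) {x : EuclideanSpace ℝ (Fin N)} (hx : x ∈ S) :
    LineDifferentiableAt ℝ F x (EuclideanSpace.single k 1) := by
  -- At j = 0 nothing has yet been differentiated: the intermediate multi-index is zero.
  have h1 := h k 0 (by simp) x hx
  have h2 : (fun i => if i < k then 0 else if i = k then 0 else (Pi.single k 1 : Fin N → ℕ) i)
      = fun _ => 0 := by
    funext i
    by_cases hi : i = k <;> simp [hi]
  rwa [h2, multiPartial_zero] at h1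

/-! ### Likelihood ratios and scores in L² of the law at `x₀`. -/

namespace ReferencedProblem

variable {N M : ℕ} (P : ReferencedProblem N M)

theorem isProbabilityMeasure_law : IsProbabilityMeasure (P.law P.x₀) := by
  constructor
  rw [EstimationProblem.law, withDensity_apply _ MeasurableSet.univ, Measure.restrict_univ]
  exact P.lintegral_pdf _ P.x₀_mem

theorem ae_law {p : EuclideanSpace ℝ (Fin M) → Prop} (h : ∀ᵐ y ∂P.base, p y) :
    ∀ᵐ y ∂P.law P.x₀, p y :=
  (withDensity_absolutelyContinuous _ _).ae_le h

theorem measurable_pdf_x₀ : Measurable (P.pdf P.x₀) := P.measurable_pdf _ P.x₀_mem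

theorem integral_law (g : EuclideanSpace ℝ (Fin M) → ℝ) :
    ∫ y, g y ∂P.law P.x₀ = ∫ y, P.pdf P.x₀ y * g y ∂P.base := by
  rw [EstimationProblem.law, integral_withDensity_eq_integral_toReal_smul
    P.measurable_pdf_x₀.ennreal_ofReal (by simp)]
  simp [ENNReal.toReal_ofReal (P.pdf_nonneg _ P.x₀_mem _)]

theorem integrable_law_iff (g : EuclideanSpace ℝ (Fin M) → ℝ) :
    Integrable g (P.law P.x₀) ↔ Integrable (fun y => P.pdf P.x₀ y * g y) P.base := by
  rw [EstimationProblem.law, integrable_withDensity_iff_integrable_smul'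
    P.measurable_pdf_x₀.ennreal_ofReal (by simp)]
  simp [ENNReal.toReal_ofReal (P.pdf_nonneg _ P.x₀_mem _)]

theorem memLp_likelihoodRatio {x : EuclideanSpace ℝ (Fin N)} (hx : x ∈ P.paramSet) :
    MemLp (P.likelihoodRatio P.x₀ x) 2 (P.law P.x₀) := by
  have hm : Measurable (P.likelihoodRatio P.x₀ x) := (P.measurable_pdf x hx).div P.measurable_pdf_x₀
  rw [memLp_two_iff_integrable_sq hm.aestronglyMeasurable]
  simpa [sq] using P.integrable_ratio x hx x hx

/-- The factor f(y;x₀) cancels off a null set, which turns means under every x into pairings under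
the one law at `x₀`. -/
theorem mean_eq_integral_likelihoodRatio (h : EuclideanSpace ℝ (Fin M) → ℝ)
    (x : EuclideanSpace ℝ (Fin N)) :
    P.mean h x = ∫ y, h y * P.likelihoodRatio P.x₀ x y ∂P.law P.x₀ := by
  rw [P.integral_law, EstimationProblem.mean]
  refine integral_congr_ae ?_
  filter_upwards [P.pdf_ne_zero] with y hy
  rw [EstimationProblem.likelihoodRatio]
  field_simp

theorem likelihoodRatio_self : P.likelihoodRatio P.x₀ P.x₀ =ᵐ[P.law P.x₀] fun _ => 1 := by
  filter_upwards [P.ae_law P.pdf_ne_zero] with y hy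
  exact div_self hy

theorem integrable_mul_pdf {h : EuclideanSpace ℝ (Fin M) → ℝ} (hh : MemLp h 2 (P.law P.x₀))
    {x : EuclideanSpace ℝ (Fin N)} (hx : x ∈ P.paramSet) :
    Integrable (fun y => h y * P.pdf x y) P.base := by
  have := (P.integrable_law_iff _).1 (hh.integrable_mul (P.memLp_likelihoodRatio hx))
  refine this.congr ?_
  filter_upwards [P.pdf_ne_zero] with y hy
  simp only [Pi.mul_apply, EstimationProblem.likelihoodRatio]
  field_simp

/-- The partial derivative `∂_{x_k} f(y;x)` of the density, divided by `f(y;x₀)`. -/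
noncomputable def score (k : Fin N) (x : EuclideanSpace ℝ (Fin N))
    (y : EuclideanSpace ℝ (Fin M)) : ℝ :=
  1 / P.pdf P.x₀ y * partialDeriv k (fun x => P.pdf x y) x

variable {P}

/-- The consequences of regularity up to order one for the first partial derivatives, as statements
about square integrable functions. -/
theorem IsRegular.exists_ball (hreg : P.IsRegular 1) :
    ∃ r > 0, Metric.ball P.x₀ r ⊆ P.paramSet ∧
      (∀ k, ∀ᵐ y ∂P.base, ∀ x ∈ Metric.ball P.x₀ r,
        LineDifferentiableAt ℝ (fun x => P.pdf x y) x (EuclideanSpace.single k 1)) ∧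
      (∀ k, ∀ x ∈ Metric.ball P.x₀ r, MemLp (P.score k x) 2 (P.law P.x₀)) ∧
      (∀ h, MemLp h 2 (P.law P.x₀) → ∀ k, ∀ x ∈ Metric.ball P.x₀ r,
        HasLineDerivAt ℝ (P.mean h) (∫ y, h y * P.score k x y ∂P.law P.x₀) x
          (EuclideanSpace.single k 1)) ∧
      (∀ k, ContinuousOn (fun z : EuclideanSpace ℝ (Fin N) × EuclideanSpace ℝ (Fin N) =>
        ∫ y, P.score k z.1 y * P.score k z.2 y ∂P.law P.x₀)
        (Metric.ball P.x₀ r ×ˢ Metric.ball P.x₀ r)) := by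
  obtain ⟨r, hr, hball, h1, h2, h3⟩ := hreg
  have hle : ∀ k i : Fin N, (Pi.single k 1 : Fin N → ℕ) i ≤ 1 := by
    intro k i
    by_cases h : i = k
    · subst h; simp
    · simp [h]
  have hdiff : ∀ k, ∀ᵐ y ∂P.base, ∀ x ∈ Metric.ball P.x₀ r,
      LineDifferentiableAt ℝ (fun x => P.pdf x y) x (EuclideanSpace.single k 1) := by
    intro k
    filter_upwards [(h1 _ (hle k)).1] with y hy x hx
    exact hy.lineDifferentiableAt hx
  have hmem : ∀ k, ∀ x ∈ Metric.ball P.x₀ r, MemLp (P.score k x) 2 (P.law P.x₀) := by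
    intro k x hx
    -- Measurability of the score is inherited from the densities: it is an a.e. limit of difference
    -- quotients along a sequence of steps.
    have hmeas : AEStronglyMeasurable (P.score k x) (P.law P.x₀) := by
      have hopen : ∀ᶠ t in nhds (0 : ℝ),
          x + t • EuclideanSpace.single k (1 : ℝ) ∈ Metric.ball P.x₀ r := by
        have hc : ContinuousAt (fun t : ℝ => x + t • EuclideanSpace.single k (1 : ℝ)) 0 := by
          fun_prop
        exact hc.eventually_mem (by simpa using Metric.isOpen_ball.mem_nhds hx)
      obtain ⟨δ, hδ, hin⟩ := Metric.eventually_nhds_iff.1 hopen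
      -- The shift by 2 makes the step strictly smaller than δ already at n = 0.
      have htpos : ∀ n : ℕ, 0 < δ / (n + 2) := fun n => by positivity
      have ht : Filter.Tendsto (fun n : ℕ => δ / (n + 2 : ℝ)) Filter.atTop
          (nhdsWithin 0 (Set.Ioi 0)) := by
        rw [tendsto_nhdsWithin_iff]
        refine ⟨?_, Filter.Eventually.of_forall htpos⟩
        exact (Filter.tendsto_atTop_add_const_right _ _ tendsto_natCast_atTop_atTop).const_div_atTop
          δ
      have hxt : ∀ n : ℕ, x + (δ / (n + 2 : ℝ)) • EuclideanSpace.single k (1 : ℝ)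
          ∈ Metric.ball P.x₀ r := by
        intro n
        apply hin
        rw [Real.dist_0_eq_abs, abs_of_pos (htpos n), div_lt_iff₀ (by positivity)]
        nlinarith [(Nat.cast_nonneg n : (0 : ℝ) ≤ n)]
      refine aestronglyMeasurable_of_tendsto_ae Filter.atTop (f := fun (n : ℕ) y =>
        1 / P.pdf P.x₀ y * ((δ / (n + 2 : ℝ))⁻¹ •
          (P.pdf (x + (δ / (n + 2 : ℝ)) • EuclideanSpace.single k (1 : ℝ)) y - P.pdf x y))) ?_ ?_
      · intro n
        have e1 := P.measurable_pdf _ (hball (hxt n))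
        have e2 := P.measurable_pdf _ (hball hx)
        have e3 := P.measurable_pdf_x₀
        exact Measurable.aestronglyMeasurable (by fun_prop)
      · refine P.ae_law ?_
        filter_upwards [hdiff k] with y hy
        have := (hy x hx).hasLineDerivAt.tendsto_slope_zero_right
        exact (this.comp ht).const_mul _
    rw [memLp_two_iff_integrable_sq hmeas]
    simpa [score, multiPartial_single] using (h1 _ (hle k)).2 x hx
  refine ⟨r, hr, hball, hdiff, hmem, fun h hh k x hx => ?_, fun k => ?_⟩
  · have hint : ∀ x, (∫ y, h y * P.score k x y ∂P.law P.x₀)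
        = ∫ y, h y * partialDeriv k (fun x => P.pdf x y) x ∂P.base := by
      intro x
      rw [P.integral_law]
      refine integral_congr_ae ?_
      filter_upwards [P.pdf_ne_zero] with y hy
      rw [score]
      field_simp
    obtain ⟨e1, e2⟩ := h2 h (fun x hx => P.integrable_mul_pdf hh hx) (Pi.single k 1) (hle k)
      (fun x hx => by
        have := (P.integrable_law_iff _).1 (hh.integrable_mul (hmem k x hx))
        refine this.congr ?_
        filter_upwards [P.pdf_ne_zero] with y hy
        simp only [Pi.mul_apply, score, multiPartial_single]
        field_simp)
    have e3 := e2 x hx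
    simp only [multiPartial_single] at e3
    rw [hint, ← e3]
    exact (e1.lineDifferentiableAt hx).hasLineDerivAt
  · refine (h3 _ _ (hle k) (hle k)).congr fun z _ => ?_
    simp only [multiPartial_single, score]
    refine integral_congr_ae (Filter.Eventually.of_forall fun y => ?_)
    ring

/-- The mean function of a square integrable statistic is Fréchet differentiable at `x₀`. -/
theorem IsRegular.hasFDerivAt_mean (hreg : P.IsRegular 1) {h : EuclideanSpace ℝ (Fin M) → ℝ}
    (hh : MemLp h 2 (P.law P.x₀)) :
    HasFDerivAt (P.mean h) (∑ k, (∫ y, h y * P.score k P.x₀ y ∂P.law P.x₀) •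
      (EuclideanSpace.proj k : EuclideanSpace ℝ (Fin N) →L[ℝ] ℝ)) P.x₀ := by
  classical
  obtain ⟨r, hr, -, -, hmem, hder, hcont⟩ := hreg.exists_ball
  have hx₀ := Metric.mem_ball_self (x := P.x₀) hr
  refine hasFDerivAt_of_hasLineDerivAt_single (D := fun k x => ∫ y, h y * P.score k x y ∂P.law P.x₀)
    hr (hder h hh) fun k => ?_
  -- The value 0 off the ball is a harmless default, since only the germ at `x₀` matters.
  let S : EuclideanSpace ℝ (Fin N) → Lp ℝ 2 (P.law P.x₀) := fun x =>
    if hx : x ∈ Metric.ball P.x₀ r then (hmem k x hx).toLp _ else 0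
  have hS : ∀ x ∈ Metric.ball P.x₀ r, ∀ z ∈ Metric.ball P.x₀ r,
      inner ℝ (S x) (S z) = ∫ y, P.score k x y * P.score k z y ∂P.law P.x₀ := by
    intro x hx z hz
    simp only [S, dif_pos hx, dif_pos hz]
    exact inner_toLp_toLp _ _
  have hnhds := Metric.ball_mem_nhds P.x₀ hr
  have hG : ContinuousAt (fun z : EuclideanSpace ℝ (Fin N) × EuclideanSpace ℝ (Fin N) =>
      ∫ y, P.score k z.1 y * P.score k z.2 y ∂P.law P.x₀) (P.x₀, P.x₀) :=
    (hcont k).continuousAt (prod_mem_nhds hnhds hnhds)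
  have hSc : ContinuousAt S P.x₀ := by
    have g1 := hG.tendsto.comp
      (continuous_id.prodMk continuous_id : Continuous fun x => (x, x)).continuousAt.tendsto
    have g2 := hG.tendsto.comp (continuous_id.prodMk continuous_const :
      Continuous fun x => (x, P.x₀)).continuousAt.tendsto
    have g3 := (g1.sub (g2.const_mul 2)).add_const
      (∫ y, P.score k P.x₀ y * P.score k P.x₀ y ∂P.law P.x₀)
    -- With G the correlation of scores, the squared distance is G(x,x) - 2G(x,x₀) + G(x₀,x₀).
    have g4 : Filter.Tendsto (fun x => ‖S x - S P.x₀‖ ^ 2) (nhds P.x₀) (nhds 0) := by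
      refine (g3.congr' ?_).trans_eq (by congr 1; ring)
      filter_upwards [hnhds] with x hx
      rw [norm_sub_sq_real, ← real_inner_self_eq_norm_sq, ← real_inner_self_eq_norm_sq,
        hS x hx x hx, hS x hx _ hx₀, hS _ hx₀ _ hx₀]
      rfl
    rw [ContinuousAt, tendsto_iff_norm_sub_tendsto_zero]
    have := g4.sqrt
    simpa [Real.sqrt_sq] using this
  have : ContinuousAt (fun x => inner ℝ (hh.toLp h) (S x)) P.x₀ :=
    (continuous_const.inner continuous_id :
      Continuous fun v => inner ℝ (hh.toLp h) v).continuousAt.comp hSc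
  refine this.congr ?_
  filter_upwards [hnhds] with x hx
  simp only [S, dif_pos hx]
  exact inner_toLp_toLp hh _

theorem IsRegular.memLp_score (hreg : P.IsRegular 1) (k : Fin N) :
    MemLp (P.score k P.x₀) 2 (P.law P.x₀) := by
  obtain ⟨r, hr, -, -, hmem, -⟩ := hreg.exists_ball
  exact hmem k _ (Metric.mem_ball_self hr)

theorem IsRegular.hasLineDerivAt_mean (hreg : P.IsRegular 1) {h : EuclideanSpace ℝ (Fin M) → ℝ}
    (hh : MemLp h 2 (P.law P.x₀)) (k : Fin N) :
    HasLineDerivAt ℝ (P.mean h) (∫ y, h y * P.score k P.x₀ y ∂P.law P.x₀) P.x₀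
      (EuclideanSpace.single k 1) := by
  obtain ⟨r, hr, -, -, -, hder, -⟩ := hreg.exists_ball
  exact hder h hh k _ (Metric.mem_ball_self hr)

/-- The logarithmic derivative divides by f(y;x) and the score by f(y;x₀); the two agree at x = x₀.
-/
theorem IsRegular.partialDeriv_log_pdf (hreg : P.IsRegular 1) (k : Fin N) :
    (fun y => partialDeriv k (fun x => Real.log (P.pdf x y)) P.x₀) =ᵐ[P.law P.x₀]
      P.score k P.x₀ := by
  obtain ⟨r, hr, -, hdiff, -⟩ := hreg.exists_ball
  refine P.ae_law ?_
  filter_upwards [hdiff k, P.pdf_ne_zero] with y hy hy0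
  have h1 := (hy _ (Metric.mem_ball_self hr)).hasLineDerivAt
  rw [HasLineDerivAt] at h1
  have h2 := h1.log (by simpa using hy0)
  have h3 : HasLineDerivAt ℝ (fun x => Real.log (P.pdf x y)) _ P.x₀ (EuclideanSpace.single k 1) := h2
  rw [partialDeriv, h3.lineDeriv, score, partialDeriv]
  simp
  ring

theorem IsRegular.fisher_apply (hreg : P.IsRegular 1) (k l : Fin N) :
    P.fisher P.x₀ k l = ∫ y, P.score k P.x₀ y * P.score l P.x₀ y ∂P.law P.x₀ := by
  rw [EstimationProblem.fisher, Matrix.of_apply]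
  exact integral_congr_ae ((hreg.partialDeriv_log_pdf k).mul (hreg.partialDeriv_log_pdf l))

/-- The score has mean zero. -/
theorem IsRegular.integral_score (hreg : P.IsRegular 1) (k : Fin N) :
    ∫ y, P.score k P.x₀ y ∂P.law P.x₀ = 0 := by
  have := P.isProbabilityMeasure_law
  obtain ⟨r, hr, hball, -⟩ := hreg.exists_ball
  have h1 := hreg.hasLineDerivAt_mean (memLp_const (1 : ℝ)) k
  -- Normalization is available only on the parameter set, but the derivative needs it only near
  -- `x₀`.
  have h2 : (fun _ => (1 : ℝ)) =ᶠ[nhds P.x₀] P.mean fun _ => 1 := by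
    filter_upwards [Metric.ball_mem_nhds P.x₀ hr] with x hx
    have hx' := hball hx
    rw [EstimationProblem.mean]
    simp only [one_mul]
    rw [integral_eq_lintegral_of_nonneg_ae (Filter.Eventually.of_forall (P.pdf_nonneg x hx'))
      (P.measurable_pdf x hx').aestronglyMeasurable, P.lintegral_pdf x hx', ENNReal.toReal_one]
  have h3 := (h1.congr_of_eventuallyEq h2).unique
    ((hasFDerivAt_const (1 : ℝ) P.x₀).hasLineDerivAt (EuclideanSpace.single k 1))
  simpa using h3

end ReferencedProblem

/-! ### Tangency of the parametrization to the constraint set. -/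

/-- The chain rule for Jacobian matrices, along a zero set. -/
theorem jacobian_mul_jacobian_eq_zero {N Q L : ℕ}
    {c : EuclideanSpace ℝ (Fin N) → EuclideanSpace ℝ (Fin Q)}
    {r : EuclideanSpace ℝ (Fin L) → EuclideanSpace ℝ (Fin N)} {θ : EuclideanSpace ℝ (Fin L)}
    (hc : DifferentiableAt ℝ c (r θ)) (hr : DifferentiableAt ℝ r θ)
    (h : ∀ᶠ t in nhds θ, c (r t) = 0) : jacobian c (r θ) * jacobian r θ = 0 := by
  have h1 : HasFDerivAt (fun t => c (r t)) ((fderiv ℝ c (r θ)).comp (fderiv ℝ r θ)) θ :=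
    hc.hasFDerivAt.comp θ hr.hasFDerivAt
  have h2 : (fderiv ℝ c (r θ)).comp (fderiv ℝ r θ) = 0 :=
    (h1.congr_of_eventuallyEq (f₁ := fun _ => 0) (h.mono fun t ht => ht.symm)).unique
      (hasFDerivAt_const 0 θ)
  ext i l
  have h3 : fderiv ℝ c (r θ) (fderiv ℝ r θ (EuclideanSpace.single l 1)) = 0 :=
    congrArg (fun T => T (EuclideanSpace.single l (1 : ℝ))) h2
  have h4 : fderiv ℝ r θ (EuclideanSpace.single l 1)
      = ∑ k, jacobian r θ k l • EuclideanSpace.single k (1 : ℝ) := by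
    ext k
    simp [jacobian, Finset.sum_apply, Pi.single_apply]
  rw [h4, map_sum] at h3
  have h5 := congrArg (fun v : EuclideanSpace ℝ (Fin Q) => v i) h3
  simpa [Matrix.mul_apply, jacobian, mul_comm] using h5

/-! ### The RKHS as a subspace of L². -/

namespace ReferencedProblem

variable {N M : ℕ}

/-- The likelihood ratio as an element of `L²`. -/
noncomputable def ratioLp (P : ReferencedProblem N M) (x : P.paramSet) : Lp ℝ 2 (P.law P.x₀) :=
  (P.memLp_likelihoodRatio x.2).toLp _

theorem inner_ratioLp_toLp (P : ReferencedProblem N M) (x : P.paramSet)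
    {h : EuclideanSpace ℝ (Fin M) → ℝ} (hh : MemLp h 2 (P.law P.x₀)) :
    inner ℝ (P.ratioLp x) (hh.toLp h) = P.mean h x := by
  rw [ratioLp, inner_toLp_toLp, mean_eq_integral_likelihoodRatio]
  simp only [mul_comm]

/-- The congruence between the reproducing kernel Hilbert space and the closed span of the
likelihood ratios in `L²`. -/
theorem exists_linearIsometry (P : ReferencedProblem N M) :
    ∃ Φ : P.Space →ₗᵢ[ℝ] Lp ℝ 2 (P.law P.x₀),
      (∀ (f : P.Space) (x : P.paramSet), f x = inner ℝ (P.ratioLp x) (Φ f)) ∧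
      ∀ x, P.ratioLp x ∈ Set.range Φ := by
  have hker : ∀ (x : P.paramSet) (f : P.Space),
      inner ℝ (RKHS.kerFun P.Space x (1 : ℝ)) f = f x := by
    intro x f
    rw [RKHS.kerFun_inner]
    simp
  obtain ⟨Φ, hΦ⟩ := exists_linearIsometry_of_inner_eq
    (fun x : P.paramSet => RKHS.kerFun P.Space x (1 : ℝ)) P.ratioLp (by
      rw [← top_le_iff, ← RKHS.kerFun_dense P.Space]
      refine Submodule.topologicalClosure_mono (Submodule.span_le.2 ?_)
      rintro _ ⟨x, v, rfl⟩
      have : RKHS.kerFun P.Space x v = v • RKHS.kerFun P.Space x (1 : ℝ) := by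
        rw [← map_smul, smul_eq_mul, mul_one]
      rw [SetLike.mem_coe, this]
      exact Submodule.smul_mem _ _ (Submodule.subset_span ⟨x, rfl⟩)) (fun x z => by
      rw [hker, RKHS.kerFun_apply, RKHS.OfKernel.kernel_ofKernel, ratioLp, ratioLp,
        inner_toLp_toLp]
      simp [kernelMatrix, EstimationProblem.kernel])
  refine ⟨Φ, fun f x => ?_, fun x => ⟨_, hΦ x⟩⟩
  rw [← hΦ x, Φ.inner_map_map, hker]

/-- The restricted problem has the same law and ratios by definition, so its isometry lands in the
L² space of the ambient problem, where the scores live. -/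
theorem exists_linearIsometry_restrict (P : ReferencedProblem N M)
    (S : Set (EuclideanSpace ℝ (Fin N))) (hS : P.x₀ ∈ S) :
    ∃ Φ : (P.restrict S hS).Space →ₗᵢ[ℝ] Lp ℝ 2 (P.law P.x₀),
      (∀ (f : (P.restrict S hS).Space) (x : (P.restrict S hS).paramSet),
        f x = inner ℝ (P.ratioLp ⟨x, x.2.1⟩) (Φ f)) ∧
      ∀ x : (P.restrict S hS).paramSet, P.ratioLp ⟨x, x.2.1⟩ ∈ Set.range Φ :=
  (P.restrict S hS).exists_linearIsometry

end ReferencedProblem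

/-! ### The constrained Cramér–Rao bound. -/

theorem theorem2 {N M Q : ℕ} (hQN : Q ≤ N)
    -- the estimation problem with its (ambient) parameter set, regular up to order 1 at `x₀`
    (P : ReferencedProblem N M) (hreg : P.IsRegular 1)
    -- the constraints
    (c : EuclideanSpace ℝ (Fin N) → EuclideanSpace ℝ (Fin Q)) (hc : ContDiff ℝ 1 c)
    (hrank : ∀ x ∈ P.paramSet, c x = 0 → (jacobian c x).rank = Q)
    (hx₀ : P.x₀ ∈ {x | c x = 0})
    -- an orthonormal basis of the null space of the Jacobian matrix of the constraints
    (U : Matrix (Fin N) (Fin (N - Q)) ℝ) (hU : jacobian c P.x₀ * U = 0) (hUU : Uᵀ * U = 1)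
    -- a local continuously differentiable parametrization of the constrained parameter set
    (r : EuclideanSpace ℝ (Fin (N - Q)) → EuclideanSpace ℝ (Fin N))
    (O : Set (EuclideanSpace ℝ (Fin (N - Q)))) (hO : IsOpen O) (hr : ContDiffOn ℝ 1 r O)
    (hrO : Set.MapsTo r O (P.restrict {x | c x = 0} hx₀).paramSet)
    (θ₀ : EuclideanSpace ℝ (Fin (N - Q))) (hθ₀ : θ₀ ∈ O) (hrθ₀ : r θ₀ = P.x₀)
    (hrinj : (jacobian r θ₀).rank = N - Q)
    -- an estimator with finite variance at `x₀`
    (ghat : EuclideanSpace ℝ (Fin M) → ℝ) (hmeas : Measurable ghat)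
    (hvar : MemLp ghat 2 (P.law P.x₀)) :
    -- the gradient `b` of the mean function and the Fisher information matrix exist
    (∀ k, LineDifferentiableAt ℝ (P.mean ghat) P.x₀ (EuclideanSpace.single k 1)) ∧
    (∀ k l, Integrable (fun y => partialDeriv k (fun x => Real.log (P.pdf x y)) P.x₀ *
      partialDeriv l (fun x => Real.log (P.pdf x y)) P.x₀) (P.law P.x₀)) ∧
    -- `γ`, `u₀` and the `u_l` belong to the RKHS of the constrained problem
    ∃ (γ u₀ : (P.restrict {x | c x = 0} hx₀).Space)
      (u : Fin (N - Q) → (P.restrict {x | c x = 0} hx₀).Space),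
      (∀ x, γ x = P.mean ghat x) ∧
      (∀ x, u₀ x = P.kernel P.x₀ x P.x₀) ∧
      (∀ (l : Fin (N - Q)) (x : (P.restrict {x | c x = 0} hx₀).paramSet),
        HasLineDerivAt ℝ (fun θ => P.kernel P.x₀ x (r θ)) (u l x) θ₀
        (EuclideanSpace.single l 1)) ∧
      -- the projection bound is the constrained Cramér-Rao bound, and it bounds the variance
      (let b : Fin N → ℝ := fun k => partialDeriv k (P.mean ghat) P.x₀
       let ccrb : ℝ := b ⬝ᵥ ((U * pinv (Uᵀ * P.fisher P.x₀ * U) * Uᵀ) *ᵥ b)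
       ‖(spanWith u₀ u).starProjection γ‖ ^ 2 - P.mean ghat P.x₀ ^ 2 = ccrb ∧
       ccrb ≤ ProbabilityTheory.variance ghat (P.law P.x₀)) := by
  have := P.isProbabilityMeasure_law
  refine ⟨fun k => (hreg.hasLineDerivAt_mean hvar k).lineDifferentiableAt, fun k l =>
    ((hreg.memLp_score k).integrable_mul (hreg.memLp_score l)).congr
      ((hreg.partialDeriv_log_pdf k).mul (hreg.partialDeriv_log_pdf l)).symm, ?_⟩
  set R := P.restrict {x | c x = 0} hx₀ with hR
  have hOn : O ∈ nhds θ₀ := hO.mem_nhds hθ₀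
  have hrd : DifferentiableAt ℝ r θ₀ := (hr.contDiffAt hOn).differentiableAt one_ne_zero
  set A := jacobian r θ₀ with hA
  -- the derivative of mean functions along the parametrization
  have hderiv : ∀ {h : EuclideanSpace ℝ (Fin M) → ℝ}, MemLp h 2 (P.law P.x₀) → ∀ l,
      HasLineDerivAt ℝ (fun θ => P.mean h (r θ))
        (∑ k, A k l * ∫ y, h y * P.score k P.x₀ y ∂P.law P.x₀) θ₀ (EuclideanSpace.single l 1) := by
    intro h hh l
    have h1 := hreg.hasFDerivAt_mean hh
    rw [← hrθ₀] at h1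
    have h2 := (h1.comp θ₀ hrd.hasFDerivAt).hasLineDerivAt (EuclideanSpace.single l 1)
    rw [hrθ₀] at h2
    convert! h2 using 1
    simp [A, jacobian, mul_comm]
  let s : Fin N → Lp ℝ 2 (P.law P.x₀) := fun k => (hreg.memLp_score k).toLp _
  let w : Fin (N - Q) → Lp ℝ 2 (P.law P.x₀) := fun l => ∑ k, A k l • s k
  have hwin : ∀ {h : EuclideanSpace ℝ (Fin M) → ℝ} (hh : MemLp h 2 (P.law P.x₀)) (l),
      inner ℝ (hh.toLp h) (w l) = ∑ k, A k l * ∫ y, h y * P.score k P.x₀ y ∂P.law P.x₀ := by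
    intro h hh l
    simp only [w, s, inner_sum, inner_smul_right, inner_toLp_toLp]
  obtain ⟨Φ, hΦ, hΦρ⟩ := P.exists_linearIsometry_restrict {x | c x = 0} hx₀
  -- The adjoint takes a statistic to its mean function: each ratio is some Φ k, so Φ cancels
  -- against its adjoint.
  have hadj : ∀ (v : Lp ℝ 2 (P.law P.x₀)) (x : R.paramSet),
      (Φ.toContinuousLinearMap.adjoint v : R.Space) x = inner ℝ (P.ratioLp ⟨x, x.2.1⟩) v := by
    intro v x
    obtain ⟨k, hk⟩ := hΦρ x
    rw [hΦ, ← hk, Φ.inner_map_map, ContinuousLinearMap.adjoint_inner_right]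
    rfl
  -- The range of Φ is complete, hence equal to its double orthogonal complement. A φ orthogonal to
  -- it has mean zero at every r θ near θ₀, so the derivative of that mean, which is ⟨φ, w l⟩,
  -- vanishes.
  have hwmem : ∀ l, ∃ f : R.Space, Φ f = w l := by
    intro l
    have hcomplete : IsComplete (LinearMap.range Φ.toLinearMap : Set (Lp ℝ 2 (P.law P.x₀))) := by
      rw [LinearMap.coe_range]
      exact Φ.isometry.isUniformInducing.isComplete_range
    have : CompleteSpace (LinearMap.range Φ.toLinearMap) :=
      completeSpace_coe_iff_isComplete.2 hcomplete
    change w l ∈ LinearMap.range Φ.toLinearMap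
    rw [← Submodule.orthogonal_orthogonal (LinearMap.range Φ.toLinearMap)]
    rw [Submodule.mem_orthogonal']
    intro φ hφ
    have hφL : (Lp.memLp φ).toLp φ = φ := Lp.toLp_coeFn φ _
    rw [real_inner_comm, ← hφL, hwin]
    have h0 : (fun _ => (0 : ℝ)) =ᶠ[nhds θ₀] fun θ => P.mean φ (r θ) := by
      filter_upwards [hOn] with θ hθ
      have h1 := P.inner_ratioLp_toLp ⟨r θ, (hrO hθ).1⟩ (Lp.memLp φ)
      rw [hφL] at h1
      obtain ⟨k, hk⟩ := hΦρ ⟨r θ, hrO hθ⟩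
      have h2 := (Submodule.mem_orthogonal _ _).1 hφ _ ⟨k, rfl⟩
      change inner ℝ (Φ k) φ = 0 at h2
      rw [hk, h1] at h2
      exact h2.symm
    have h1 := ((hderiv (Lp.memLp φ) l).congr_of_eventuallyEq h0).unique
      ((hasFDerivAt_const (0 : ℝ) θ₀).hasLineDerivAt (EuclideanSpace.single l 1))
    simpa using h1
  choose u hu using hwmem
  obtain ⟨u₀, hu₀⟩ := hΦρ ⟨P.x₀, R.x₀_mem⟩
  set γ : R.Space := Φ.toContinuousLinearMap.adjoint (hvar.toLp ghat) with hγ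
  have hγx : ∀ x, γ x = P.mean ghat x := fun x => by
    rw [hγ, hadj]
    exact P.inner_ratioLp_toLp _ hvar
  have hinγ : ∀ f : R.Space, inner ℝ f γ = inner ℝ (Φ f) (hvar.toLp ghat) := fun f =>
    ContinuousLinearMap.adjoint_inner_right _ _ _
  have hu₀γ : inner ℝ u₀ γ = P.mean ghat P.x₀ := by
    rw [hinγ, hu₀]
    exact P.inner_ratioLp_toLp _ hvar
  have hone : P.ratioLp ⟨P.x₀, P.x₀_mem⟩ = (memLp_const (1 : ℝ)).toLp _ :=
    (MemLp.toLp_eq_toLp_iff _ _).2 P.likelihoodRatio_self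
  have hu₀u₀ : inner ℝ u₀ u₀ = (1 : ℝ) := by
    rw [← Φ.inner_map_map, hu₀, hone]
    refine (inner_toLp_toLp _ _).trans ?_
    simp
  have hu₀u : ∀ l, inner ℝ u₀ (u l) = (0 : ℝ) := by
    intro l
    rw [← Φ.inner_map_map, hu₀, hone, hu]
    refine (hwin _ l).trans ?_
    simp [hreg.integral_score]
  refine ⟨γ, u₀, u, hγx, fun x => ?_, fun l x => ?_, ?_⟩
  · rw [hΦ, hu₀]
    exact inner_toLp_toLp _ _
  · rw [hΦ, hu]
    have h1 := hderiv (P.memLp_likelihoodRatio x.2.1) l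
    rw [← hwin (P.memLp_likelihoodRatio x.2.1)] at h1
    refine h1.congr_of_eventuallyEq (Filter.Eventually.of_forall fun θ => ?_)
    exact (P.mean_eq_integral_likelihoodRatio _ _).symm
  · intro b ccrb
    obtain ⟨z, hz, hnorm⟩ := exists_norm_sq_starProjection_spanWith γ hu₀u₀ hu₀u
    have hb : ∀ k, b k = inner ℝ (s k) (hvar.toLp ghat) := by
      intro k
      rw [real_inner_comm]
      exact (hreg.hasLineDerivAt_mean hvar k).lineDeriv.trans (inner_toLp_toLp _ _).symm
    have hJ : ∀ k l, P.fisher P.x₀ k l = inner ℝ (s k) (s l) := fun k l =>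
      (hreg.fisher_apply k l).trans (inner_toLp_toLp _ _).symm
    have hJt : (P.fisher P.x₀)ᵀ = P.fisher P.x₀ := by
      ext k l
      rw [Matrix.transpose_apply, hJ, hJ, real_inner_comm]
    -- B holds the coordinates of the tangent vectors, the columns of A, in the orthonormal basis U.
    obtain ⟨B, hB⟩ : ∃ B, B = Uᵀ * A := ⟨_, rfl⟩
    have hcA : jacobian c P.x₀ * A = 0 := by
      rw [← hrθ₀]
      exact jacobian_mul_jacobian_eq_zero (hc.differentiable one_ne_zero _) hrd
        (Filter.mem_of_superset hOn fun θ hθ => (hrO hθ).2)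
    have hUB : U * B = A := hB ▸ mul_transpose_mul_of_mul_eq_zero
      (hrank _ P.x₀_mem hx₀) hU hUU hcA
    have hBunit : IsUnit B := by
      apply Matrix.isUnit_of_rank_eq
      refine le_antisymm (by simpa using B.rank_le_width) ?_
      calc N - Q = (U * B).rank := by rw [hUB, hrinj]
        _ ≤ B.rank := Matrix.rank_mul_le_right _ _
    set G' := Uᵀ * P.fisher P.x₀ * U with hG'
    have hG't : G'ᵀ = G' := by
      rw [hG', Matrix.transpose_mul, Matrix.transpose_mul, hJt, Matrix.transpose_transpose,
        Matrix.mul_assoc]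
    have hG : Matrix.of (fun l m => inner ℝ (u l) (u m)) = Bᵀ * G' * B := by
      have : Bᵀ * G' * B = Aᵀ * P.fisher P.x₀ * A := by
        rw [← hUB, Matrix.transpose_mul U]
        simp only [hG', Matrix.mul_assoc]
      rw [this]
      ext l m
      rw [Matrix.of_apply, ← Φ.inner_map_map, hu, hu]
      simp only [w, sum_inner, inner_sum, inner_smul_left, inner_smul_right, Matrix.mul_apply,
        Matrix.transpose_apply, hJ, Finset.sum_mul]
      simp only [conj_trivial, Finset.mul_sum]
      refine Finset.sum_congr rfl fun k _ => Finset.sum_congr rfl fun j _ => ?_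
      ring
    have ha : (fun l => inner ℝ (u l) γ) = Bᵀ *ᵥ (Uᵀ *ᵥ b) := by
      rw [Matrix.mulVec_mulVec, ← Matrix.transpose_mul, hUB]
      funext l
      rw [hinγ, hu]
      simp [w, sum_inner, inner_smul_left, Matrix.mulVec, dotProduct, hb]
    -- Cancelling the invertible Bᵀ from the normal equations exhibits Uᵀb in the range of G', so G'
    -- itself may be singular.
    have hnormal : G' *ᵥ (B *ᵥ z) = Uᵀ *ᵥ b := by
      have hBt : IsUnit Bᵀ := (Matrix.isUnit_transpose _).2 hBunit
      apply Matrix.mulVec_injective_of_isUnit hBt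
      rw [← ha, ← hz, hG]
      simp only [Matrix.mulVec_mulVec, Matrix.mul_assoc]
    have hccrb : ccrb = z ⬝ᵥ (Matrix.of (fun l m => inner ℝ (u l) (u m)) *ᵥ z) := by
      have h1 : ccrb = (Uᵀ *ᵥ b) ⬝ᵥ (pinv G' *ᵥ (Uᵀ *ᵥ b)) := by
        simp only [ccrb, ← Matrix.mulVec_mulVec]
        rw [Matrix.dotProduct_mulVec, ← Matrix.mulVec_transpose]
      rw [h1, ← hnormal, dotProduct_pinv_mulVec_mulVec hG't, hG, Matrix.mul_assoc,
        ← Matrix.mulVec_mulVec z, Matrix.dotProduct_mulVec z, Matrix.vecMul_transpose,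
        Matrix.mulVec_mulVec]
    have heq : ‖(spanWith u₀ u).starProjection γ‖ ^ 2 - P.mean ghat P.x₀ ^ 2 = ccrb := by
      rw [hccrb, ← hnorm, hu₀γ]
    refine ⟨heq, ?_⟩
    have hle : ‖(spanWith u₀ u).starProjection γ‖ ≤ ‖hvar.toLp ghat‖ :=
      calc _ ≤ ‖γ‖ := Submodule.norm_starProjection_apply_le _ _
        _ ≤ ‖Φ.toContinuousLinearMap.adjoint‖ * ‖hvar.toLp ghat‖ :=
          ContinuousLinearMap.le_opNorm _ _
        _ ≤ 1 * ‖hvar.toLp ghat‖ := by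
          refine mul_le_mul_of_nonneg_right ?_ (norm_nonneg _)
          rw [LinearIsometryEquiv.norm_map]
          exact Φ.norm_toContinuousLinearMap_le
        _ = _ := one_mul _
    have hmean : P.mean ghat P.x₀ = ∫ y, ghat y ∂P.law P.x₀ := by
      rw [P.mean_eq_integral_likelihoodRatio]
      refine integral_congr_ae ?_
      filter_upwards [P.likelihoodRatio_self] with y hy
      rw [hy, mul_one]
    rw [← heq, ProbabilityTheory.variance_eq_sub hvar, hmean]
    refine sub_le_sub_right ?_ _
    calc _ ≤ ‖hvar.toLp ghat‖ ^ 2 := pow_le_pow_left₀ (norm_nonneg _) hle 2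
      _ = _ := by
        rw [← real_inner_self_eq_norm_sq, inner_toLp_toLp]
        simp [sq]
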